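/- Let $q$ be a prime power, let $n\ge 3$ and $0\le d\le q$ be integers, and let $H=(h_{ij})_{0\le i,j\le n}$ be a Hermitian matrix over $\mathbb F_{q^2}$, that is, $H\neq 0$ and $h_{ij}=h_{ji}^{\,q}$ for all $i,j$. Suppose that $H$ has rank $n$, and let $P\mathcal U_{n-1}\subset\mathbb P^n$ be the degenerate Hermitian variety of rank $n$ defined by $$\sum_{i,j=0}^{n} h_{ij}\,x_i\,x_j^{\,q}=0 .$$ Let $\mathbb F_{q^2}[x_0,\dots,x_n]_d$ be the space of homogeneous polynomials of degree $d$ over $\mathbb F_{q^2}$ together with $0$, and represent each point $\mathsf P\in P\mathcal U_{n-1}(\mathbb F_{q^2})$ by its homogeneous coordinate vector whose last non-zero coordinate is $1$. Then the linear evaluation map $$\mathrm{ev}:\mathbb F_{q^2}[x_0,\dots,x_n]_d\to \mathbb F_{q^2}^{\,P\mathcal U_{n-1}(\mathbb F_{q^2})},\qquad F\mapsto \bigl(F(\mathsf P)\bigr)_{\mathsf P\in P\mathcal U_{n-1}(\mathbb F_{q^2})},$$ is injective. In particular, for every non-zero $F\in\mathbb F_{q^2}[x_0,\dots,x_n]_d$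 there is a point of $P\mathcal U_{n-1}(\mathbb F_{q^2})$ at which $F$ does not vanish. -/

import Mathlib

namespace HermitianCode

variable {K : Type*} [Field K]

/-- Hermitian matrices over the field with `q ^ 2` elements: `H ≠ 0` and `Hᵀ = H^(q)`, where
`H^(q)` is obtained from `H` by raising every entry to the `q`-th power. -/
def IsHermitianMatrix {n : ℕ} (q : ℕ) (H : Matrix (Fin (n + 1)) (Fin (n + 1)) K) : Prop :=
  H ≠ 0 ∧ H.transpose = H.map (fun a => a ^ q)

/-- The polynomial `xᵀ H x^(q) = ∑ i j, h_ij x_i x_j ^ q`. -/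
noncomputable def hermitianPoly {n : ℕ} (q : ℕ) (H : Matrix (Fin (n + 1)) (Fin (n + 1)) K) :
    MvPolynomial (Fin (n + 1)) K :=
  ∑ i, ∑ j, MvPolynomial.C (H i j) * MvPolynomial.X i * MvPolynomial.X j ^ q

/-- `F` vanishes at the rational point `P` of projective space: it vanishes at every vector of
homogeneous coordinates of `P`. -/
def VanishesAt {n : ℕ} (F : MvPolynomial (Fin (n + 1)) K)
    (P : Projectivization K (Fin (n + 1) → K)) : Prop :=
  ∀ (v : Fin (n + 1) → K) (hv : v ≠ 0), Projectivization.mk K v hv = P → MvPolynomial.eval v F = 0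

/-- The set of `K`-rational points of the Hermitian variety defined by `H`. -/
def hermitianPoints {n : ℕ} (q : ℕ) (H : Matrix (Fin (n + 1)) (Fin (n + 1)) K) :
    Set (Projectivization K (Fin (n + 1) → K)) :=
  {P | VanishesAt (hermitianPoly q H) P}

/-- The last non-zero coordinate of `v` is `1`. -/
def IsNormalized {n : ℕ} (v : Fin (n + 1) → K) : Prop :=
  ∃ i, v i = 1 ∧ ∀ j, i < j → v j = 0

theorem IsNormalized.ne_zero {n : ℕ} {v : Fin (n + 1) → K} (h : IsNormalized v) : v ≠ 0 := by
  obtain ⟨i, hi, -⟩ := h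
  rintro rfl
  simp at hi

theorem existsUnique_normalized {n : ℕ} (P : Projectivization K (Fin (n + 1) → K)) :
    ∃! v : Fin (n + 1) → K, IsNormalized v ∧ ∃ hv : v ≠ 0, Projectivization.mk K v hv = P := by
  classical
  induction P using Projectivization.ind with
  | h w hw =>
    have hne : (Finset.univ.filter (fun i => w i ≠ 0)).Nonempty := by
      obtain ⟨i, hi⟩ := Function.ne_iff.mp hw
      exact ⟨i, by simpa using hi⟩
    set m := (Finset.univ.filter (fun i => w i ≠ 0)).max' hne with hm
    have hwm : w m ≠ 0 := by
      have := Finset.max'_mem _ hne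
      simpa using this
    have hgt : ∀ j, m < j → w j = 0 := by
      intro j hj
      by_contra h
      exact absurd (Finset.le_max' _ j (by simpa using h)) (not_le.mpr hj)
    have hN : IsNormalized ((w m)⁻¹ • w) :=
      ⟨m, by simp [hwm], fun j hj => by simp [hgt j hj]⟩
    refine ⟨(w m)⁻¹ • w, ⟨hN, hN.ne_zero, ?_⟩, ?_⟩
    · rw [Projectivization.mk_eq_mk_iff']
      exact ⟨(w m)⁻¹, rfl⟩
    · rintro v ⟨⟨i, hi, hj⟩, hv, hP⟩
      rw [Projectivization.mk_eq_mk_iff'] at hP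
      obtain ⟨a, rfl⟩ := hP
      have ha : a ≠ 0 := by
        rintro rfl
        simp at hv
      have him : i = m := by
        rcases lt_trichotomy i m with h | h | h
        · have := hj m h
          simp [ha, hwm] at this
        · exact h
        · simp [hgt i h] at hi
      subst him
      have : a = (w m)⁻¹ := eq_inv_of_mul_eq_one_left (by simpa using hi)
      rw [this]

/-- The vector of homogeneous coordinates of `P` whose last non-zero coordinate is `1`. -/
noncomputable def normRep {n : ℕ} (P : Projectivization K (Fin (n + 1) → K)) : Fin (n + 1) → K :=
  (existsUnique_normalized P).choose

/-- Evaluation of the forms of degree `d` (together with `0`) at the normalized coordinate vectors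
of the points of `S`; the coordinates of the target are indexed by the points of `S`. -/
noncomputable def evalMap {n : ℕ} (d : ℕ) (S : Set (Projectivization K (Fin (n + 1) → K))) :
    MvPolynomial.homogeneousSubmodule (Fin (n + 1)) K d →ₗ[K] (S → K) where
  toFun F := fun P => MvPolynomial.eval (normRep P.1) F.1
  map_add' F G := by
    funext P
    simp
  map_smul' c F := by
    funext P
    simp [MvPolynomial.smul_eval]

end HermitianCode

/-!
Restrict a form `F` of degree at most `q` to a line. If `v` is a non-isotropic vector and `w` a
non-isotropic vector orthogonal to it, then `v + t • w` is isotropic exactly when `t ^ (q + 1)` is a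
certain non-zero element of the subfield with `q` elements. Such an element has `q + 1` distinct
`(q + 1)`-st roots, so `F` vanishes identically on the line and in particular at `v`. The vector `w`
is missing only if the form is alternating on the orthogonal complement of `v`; a Hermitian form is
then zero there, so that its rank is one.
-/

namespace HermitianCode

section Polynomial

open Polynomial

/-- The restriction `t ↦ F (v + t • w)` of `F` to the line through `v` with direction `w`. -/
noncomputable def restrictToLine {R ι : Type*} [CommSemiring R] (F : MvPolynomial ι R)
    (v w : ι → R) : R[X] :=
  MvPolynomial.aeval (fun i => C (w i) * X + C (v i)) F

theorem eval_restrictToLine {R ι : Type*} [CommSemiring R] (F : MvPolynomial ι R) (v w : ι → R)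
    (t : R) : (restrictToLine F v w).eval t = MvPolynomial.eval (v + t • w) F := by
  have hpoint : (fun i => aeval t (C (w i) * X + C (v i))) = v + t • w := by
    funext i
    rw [coe_aeval_eq_eval, eval_add, eval_mul, eval_C, eval_C, eval_X, mul_comm, add_comm]
    rfl
  rw [restrictToLine, ← coe_aeval_eq_eval, MvPolynomial.comp_aeval_apply, hpoint,
    MvPolynomial.aeval_eq_eval]

theorem natDegree_restrictToLine_le {R ι : Type*} [CommSemiring R] (F : MvPolynomial ι R)
    (v w : ι → R) : (restrictToLine F v w).natDegree ≤ F.totalDegree := by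
  rw [← mul_one F.totalDegree]
  exact MvPolynomial.aeval_natDegree_le F le_rfl _ fun _ => natDegree_linear_le

theorem eval_smul_of_isHomogeneous {R ι : Type*} [CommSemiring R] {F : MvPolynomial ι R} {d : ℕ}
    (hF : F.IsHomogeneous d) (c : R) (v : ι → R) :
    MvPolynomial.eval (c • v) F = c ^ d * MvPolynomial.eval v F := by
  simp only [MvPolynomial.eval_eq, Finset.mul_sum]
  refine Finset.sum_congr rfl fun m hm => ?_
  rw [hF.degree_eq_sum_deg_support hm]
  simp only [Pi.smul_apply, smul_eq_mul, mul_pow, Finset.prod_mul_distrib,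
    Finset.prod_pow_eq_pow_sum]
  ring

variable {K : Type*} [Field K] [Fintype K]

theorem eq_zero_of_forall_ne_zero_eval_eq_zero {ι : Type*} [Finite ι] [Nonempty ι]
    {F : MvPolynomial ι K} (hdeg : F.totalDegree + 1 < Fintype.card K)
    (hF : ∀ v ≠ 0, MvPolynomial.eval v F = 0) : F = 0 := by
  obtain ⟨i⟩ := ‹Nonempty ι›
  -- The factor `X i` takes care of the vector `0`.
  suffices h : F * MvPolynomial.X i = 0 from
    (mul_eq_zero.mp h).resolve_right (MvPolynomial.X_ne_zero i)
  refine MvPolynomial.eq_zero_of_eval_zero_at_prod_finset _ (fun _ => Finset.univ)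
    (fun j => ?_) (fun v _ => ?_)
  · calc (F * MvPolynomial.X i).degreeOf j
        ≤ (F * MvPolynomial.X i).totalDegree := MvPolynomial.degreeOf_le_totalDegree _ _
      _ ≤ F.totalDegree + (MvPolynomial.X i : MvPolynomial ι K).totalDegree :=
        MvPolynomial.totalDegree_mul _ _
      _ < Fintype.card K := by rwa [MvPolynomial.totalDegree_X]
  · rcases eq_or_ne v 0 with rfl | hv
    · simp
    · simp [hF v hv]

theorem dvd_of_dvd_X_pow_card_sub_X {p G : K[X]} (hp : p ∣ X ^ Fintype.card K - X)
    (hroots : ∀ t, p.IsRoot t → G.IsRoot t) : p ∣ G := by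
  rcases eq_or_ne G 0 with rfl | hG
  · exact dvd_zero p
  have hne : (X ^ Fintype.card K - X : K[X]) ≠ 0 :=
    FiniteField.X_pow_card_sub_X_ne_zero K Fintype.one_lt_card
  have hsplits : (X ^ Fintype.card K - X : K[X]).Splits := by
    rw [splits_iff_card_roots, FiniteField.roots_X_pow_card_sub_X,
      FiniteField.X_pow_card_sub_X_natDegree_eq K Fintype.one_lt_card]
    rfl
  have hnodup : p.roots.Nodup :=
    Multiset.nodup_of_le (roots.le_of_dvd hne hp)
      (FiniteField.roots_X_pow_card_sub_X K ▸ Finset.univ.nodup)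
  refine (hsplits.of_dvd hne hp).dvd_of_roots_le_roots (ne_zero_of_dvd_ne_zero hne hp) ?_
  rw [Multiset.le_iff_subset hnodup]
  exact fun t ht => (mem_roots hG).mpr (hroots t (isRoot_of_mem_roots ht))

theorem X_pow_succ_sub_C_dvd {R : Type*} [CommRing R] [IsDomain R] {q : ℕ} (hq : q ≠ 0) {c : R}
    (hc : c ≠ 0) (hcq : c ^ q = c) : (X ^ (q + 1) - C c : R[X]) ∣ X ^ q ^ 2 - X := by
  obtain ⟨r, rfl⟩ := Nat.exists_eq_succ_of_ne_zero hq
  have hcr : c ^ r = 1 := mul_right_cancel₀ hc (by rw [← pow_succ, hcq, one_mul])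
  have hfactor : (X ^ (r + 1) ^ 2 - X : R[X]) = ((X ^ (r + 1 + 1)) ^ r - C c ^ r) * X := by
    rw [← C_pow, hcr, C_1]
    ring
  exact hfactor ▸ (sub_dvd_pow_sub_pow _ _ r).mul_right X

theorem one_lt_of_card_eq_sq {q : ℕ} (hK : Fintype.card K = q ^ 2) : 1 < q :=
  (Nat.one_lt_pow_iff two_ne_zero).mp (hK ▸ Fintype.one_lt_card)

theorem eq_zero_of_eval_eq_zero_of_pow_succ_eq {q : ℕ} (hK : Fintype.card K = q ^ 2) {c : K}
    (hc : c ≠ 0) (hcq : c ^ q = c) {G : K[X]} (hdeg : G.natDegree ≤ q)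
    (hG : ∀ t, t ^ (q + 1) = c → G.eval t = 0) : G = 0 := by
  have hq : q ≠ 0 := Nat.ne_zero_of_lt (one_lt_of_card_eq_sq hK)
  have hdvd : (X ^ (q + 1) - C c : K[X]) ∣ G :=
    dvd_of_dvd_X_pow_card_sub_X (hK ▸ X_pow_succ_sub_C_dvd hq hc hcq)
      fun t ht => hG t (by simpa [sub_eq_zero] using ht)
  refine eq_zero_of_dvd_of_natDegree_lt hdvd ?_
  rw [natDegree_X_pow_sub_C]
  omega

end Polynomial

section SesquilinearForm

theorem exists_add_map_ne_zero {R : Type*} [Ring R] {τ : R →+* R} (hτ : τ ≠ RingHom.id R) :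
    ∃ a, a + τ a ≠ 0 := by
  by_contra! h
  have hchar : (1 : R) + 1 = 0 := by simpa using h 1
  refine hτ (RingHom.ext fun a => ?_)
  calc τ a = τ a + (1 + 1) * a := by rw [hchar, zero_mul, add_zero]
    _ = (a + τ a) + a := by rw [add_mul, one_mul]; abel
    _ = a := by rw [h, zero_add]

theorem apply_add_smul_self {R M : Type*} [CommSemiring R] [AddCommMonoid M] [Module R M]
    {τ : R →+* R} {B : M →ₛₗ[τ] M →ₗ[R] R} {v w : M} (hvw : B v w = 0) (hwv : B w v = 0) (t : R) :
    B (v + t • w) (v + t • w) = B v v + τ t * t * B w w := by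
  simp only [map_add, LinearMap.map_smulₛₗ, LinearMap.add_apply, LinearMap.smul_apply, map_smul,
    smul_eq_mul, hvw, hwv]
  ring

variable {K E : Type*} [Field K] [AddCommGroup E] [Module K E] {σ : K →+* K}
  {B : E →ₛₗ[σ] E →ₗ[K] K}

theorem eq_zero_of_isSymm_of_isAlt (hσ : σ ≠ RingHom.id K) (hB : B.IsSymm) (hB' : B.IsAlt) :
    B = 0 := by
  have htrace : ∀ x y, B x y + σ (B x y) = 0 := fun x y => by
    rw [hB.eq, ← hB'.neg x y, add_neg_cancel]
  obtain ⟨a, ha⟩ := exists_add_map_ne_zero hσ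
  ext x y
  by_contra hxy
  refine ha ?_
  simpa [div_mul_cancel₀ a hxy] using htrace x ((a / B x y) • y)

theorem apply_mul_apply_self_eq_of_ortho_isotropic (hσ : σ ≠ RingHom.id K) (hB : B.IsSymm) {v : E}
    (hv : B v v ≠ 0) (hiso : ∀ w, B v w = 0 → B w w = 0) (x y : E) :
    B x y * B v v = B x v * B v y := by
  set W := LinearMap.ker (B v)
  have hW : B.domRestrict₁₂ W W = 0 :=
    eq_zero_of_isSymm_of_isAlt hσ (hB.domRestrict W) fun w => hiso w w.2
  have hproj : ∀ z, ∃ a : K, B v (z - a • v) = 0 := fun z =>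
    ⟨B v z / B v v, by rw [map_sub, map_smul, smul_eq_mul, div_mul_cancel₀ _ hv, sub_self]⟩
  obtain ⟨a, ha⟩ := hproj x
  obtain ⟨b, hb⟩ := hproj y
  have hxv : B (x - a • v) v = 0 := hB.isRefl _ _ ha
  have hxy : B (x - a • v) y = 0 := by
    have h : B (x - a • v) (y - b • v) = 0 := LinearMap.congr_fun₂ hW ⟨_, ha⟩ ⟨_, hb⟩
    rwa [map_sub, map_smul, hxv, smul_zero, sub_zero] at h
  have hexpand : ∀ z, B (x - a • v) z = B x z - σ a * B v z := fun z => by simp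
  rw [hexpand, sub_eq_zero] at hxv hxy
  rw [hxv, hxy]
  ring

end SesquilinearForm

section Conjugation

variable {K : Type*} [Field K] [Fintype K] {q : ℕ}

theorem add_pow_of_card_eq_sq (hK : Fintype.card K = q ^ 2) (a b : K) :
    (a + b) ^ q = a ^ q + b ^ q := by
  obtain ⟨p, _, m, hp, hcard⟩ := FiniteField.card' K
  obtain ⟨k, -, rfl⟩ : ∃ k ≤ (m : ℕ), q = p ^ k :=
    (Nat.dvd_prime_pow hp).mp (hcard ▸ hK ▸ dvd_pow_self q two_ne_zero)
  have : Fact p.Prime := ⟨hp⟩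
  exact add_pow_char_pow a b p k

/-- The conjugation `a ↦ a ^ q` of a field with `q ^ 2` elements over its subfield with `q`
elements. -/
def conj (hK : Fintype.card K = q ^ 2) : K →+* K where
  toFun a := a ^ q
  map_one' := one_pow q
  map_mul' a b := mul_pow a b q
  map_zero' := zero_pow (Nat.ne_zero_of_lt (one_lt_of_card_eq_sq hK))
  map_add' := add_pow_of_card_eq_sq hK

theorem conj_apply (hK : Fintype.card K = q ^ 2) (a : K) : conj hK a = a ^ q := rfl

theorem conj_conj (hK : Fintype.card K = q ^ 2) (a : K) : conj hK (conj hK a) = a := by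
  rw [conj_apply, conj_apply, ← pow_mul, ← sq, ← hK, FiniteField.pow_card]

theorem conj_ne_id (hK : Fintype.card K = q ^ 2) : conj hK ≠ RingHom.id K := by
  intro hid
  have hq := one_lt_of_card_eq_sq hK
  have hpow : ∀ x : Kˣ, x ^ (q - 1) = 1 := fun x => by
    have hx : x ^ q = x := Units.ext (by simpa [conj_apply] using DFunLike.congr_fun hid (x : K))
    rw [pow_sub x hq.le, hx, pow_one, mul_inv_cancel]
  have hdvd : q ^ 2 - 1 ∣ q - 1 := hK ▸ (FiniteField.forall_pow_eq_one_iff K (q - 1)).mp hpow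
  have hle := Nat.le_of_dvd (by omega) hdvd
  have : q < q ^ 2 := lt_self_pow₀ hq one_lt_two
  omega

end Conjugation

section Isotropic

variable {K ι : Type*} [Field K] [Fintype K] {q : ℕ} {hK : Fintype.card K = q ^ 2}
  {B : (ι → K) →ₛₗ[conj hK] (ι → K) →ₗ[K] K} {F : MvPolynomial ι K}

theorem eval_eq_zero_of_ortho_nonisotropic (hB : B.IsSymm) (hdeg : F.totalDegree ≤ q)
    (hF : ∀ u ≠ 0, B u u = 0 → MvPolynomial.eval u F = 0) {v w : ι → K} (hv : B v v ≠ 0)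
    (hvw : B v w = 0) (hw : B w w ≠ 0) : MvPolynomial.eval v F = 0 := by
  have hfixed : (-B v v / B w w) ^ q = -B v v / B w w := by
    rw [← conj_apply hK, map_div₀, map_neg, hB.eq, hB.eq]
  have hline : restrictToLine F v w = 0 := by
    refine eq_zero_of_eval_eq_zero_of_pow_succ_eq hK (div_ne_zero (neg_ne_zero.mpr hv) hw) hfixed
      ((natDegree_restrictToLine_le F v w).trans hdeg) fun t ht => ?_
    rw [eval_restrictToLine]
    refine hF _ (fun hzero => hv ?_) ?_
    · simpa [hvw] using congrArg (B v) hzero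
    · rw [apply_add_smul_self hvw (hB.isRefl _ _ hvw), conj_apply, ← pow_succ, ht,
        div_mul_cancel₀ _ hw, add_neg_cancel]
  simpa [hline] using (eval_restrictToLine F v w 0).symm

theorem eq_zero_of_forall_isotropic_eval_eq_zero [Finite ι] [Nonempty ι] (hB : B.IsSymm)
    (hortho : ∀ v, B v v ≠ 0 → ∃ w, B v w = 0 ∧ B w w ≠ 0) (hdeg : F.totalDegree ≤ q)
    (hF : ∀ u ≠ 0, B u u = 0 → MvPolynomial.eval u F = 0) : F = 0 := by
  have hcard : F.totalDegree + 1 < Fintype.card K := by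
    rw [hK]
    nlinarith [one_lt_of_card_eq_sq hK]
  refine eq_zero_of_forall_ne_zero_eval_eq_zero hcard fun v hv0 => ?_
  by_cases hv : B v v = 0
  · exact hF v hv0 hv
  · obtain ⟨w, hvw, hw⟩ := hortho v hv
    exact eval_eq_zero_of_ortho_nonisotropic hB hdeg hF hv hvw hw

end Isotropic

section HermitianForm

variable {K ι : Type*} [Field K] [Fintype K] [Fintype ι] [DecidableEq ι] {q : ℕ}

/-- The Hermitian form `x, y ↦ ∑ i j, h_ij y_i x_j ^ q` of the matrix `H`. The transpose makes it
semilinear in the first variable, as `LinearMap.IsSymm` wants it. -/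
noncomputable def hermitianForm (hK : Fintype.card K = q ^ 2) (H : Matrix ι ι K) :
    (ι → K) →ₛₗ[conj hK] (ι → K) →ₗ[K] K :=
  Matrix.toLinearMapₛₗ₂' K (conj hK) (RingHom.id K) H.transpose

variable {hK : Fintype.card K = q ^ 2} {H : Matrix ι ι K}

theorem hermitianForm_apply (x y : ι → K) :
    hermitianForm hK H x y = ∑ i, ∑ j, x i ^ q * (y j * H j i) := by
  simp [hermitianForm, Matrix.toLinearMapₛₗ₂'_apply, conj_apply]

theorem hermitianForm_single (i j : ι) :
    hermitianForm hK H (Pi.single j 1) (Pi.single i 1) = H i j :=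
  Matrix.toLinearMapₛₗ₂'_single (R := K) _ _ H.transpose j i

theorem hermitianForm_self {n : ℕ} {H : Matrix (Fin (n + 1)) (Fin (n + 1)) K}
    (v : Fin (n + 1) → K) :
    hermitianForm hK H v v = MvPolynomial.eval v (hermitianPoly q H) := by
  rw [hermitianForm_apply, Finset.sum_comm]
  simp [hermitianPoly, mul_comm, mul_left_comm, mul_assoc]

theorem isSymm_hermitianForm (hH : H.transpose = H.map (fun a => a ^ q)) :
    (hermitianForm hK H).IsSymm where
  eq x y := by
    have hentry : ∀ i j, conj hK (H i j) = H j i := fun i j => (congr_fun₂ hH i j).symm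
    simp only [hermitianForm, Matrix.toLinearMapₛₗ₂'_apply, Matrix.transpose_apply, map_sum,
      smul_eq_mul, map_mul, hentry, conj_conj, RingHom.id_apply]
    rw [Finset.sum_comm]
    simp only [mul_left_comm]

theorem rank_le_one_of_hermitianForm_mul_eq {v : ι → K} (hv : hermitianForm hK H v v ≠ 0)
    (hmul : ∀ x y, hermitianForm hK H x y * hermitianForm hK H v v =
      hermitianForm hK H x v * hermitianForm hK H v y) : H.rank ≤ 1 := by
  have hH : H = Matrix.vecMulVec (fun i => hermitianForm hK H v (Pi.single i 1))
      (fun j => hermitianForm hK H (Pi.single j 1) v / hermitianForm hK H v v) := by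
    ext i j
    rw [Matrix.vecMulVec_apply, mul_div_assoc', eq_div_iff hv, mul_comm (hermitianForm hK H v _),
      ← hmul, hermitianForm_single]
  rw [hH]
  exact Matrix.rank_vecMulVec_le _ _

theorem exists_ortho_nonisotropic (hH : H.transpose = H.map (fun a => a ^ q)) (hr : 2 ≤ H.rank)
    {v : ι → K} (hv : hermitianForm hK H v v ≠ 0) :
    ∃ w, hermitianForm hK H v w = 0 ∧ hermitianForm hK H w w ≠ 0 := by
  by_contra! hiso
  have hrank : H.rank ≤ 1 := rank_le_one_of_hermitianForm_mul_eq hv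
    (apply_mul_apply_self_eq_of_ortho_isotropic (conj_ne_id hK) (isSymm_hermitianForm hH) hv hiso)
  omega

end HermitianForm

section Points

variable {K : Type*} [Field K] {n : ℕ} {F : MvPolynomial (Fin (n + 1)) K} {d : ℕ}

theorem vanishesAt_mk_iff (hF : F.IsHomogeneous d) {v : Fin (n + 1) → K} (hv : v ≠ 0) :
    VanishesAt F (Projectivization.mk K v hv) ↔ MvPolynomial.eval v F = 0 := by
  refine ⟨fun h => h v hv rfl, fun h w hw hwv => ?_⟩
  obtain ⟨a, rfl⟩ := (Projectivization.mk_eq_mk_iff' K w v hw hv).mp hwv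
  rw [eval_smul_of_isHomogeneous hF, h, mul_zero]

theorem eval_normRep_eq_zero_iff (hF : F.IsHomogeneous d)
    (P : Projectivization K (Fin (n + 1) → K)) :
    MvPolynomial.eval (normRep P) F = 0 ↔ VanishesAt F P := by
  obtain ⟨-, hne, hmk⟩ := (existsUnique_normalized P).choose_spec.1
  exact (vanishesAt_mk_iff hF hne).symm.trans (by rw [hmk])

theorem isHomogeneous_hermitianPoly (q : ℕ) (H : Matrix (Fin (n + 1)) (Fin (n + 1)) K) :
    (hermitianPoly q H).IsHomogeneous (q + 1) := by
  refine MvPolynomial.IsHomogeneous.sum _ _ _ fun i _ =>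
    MvPolynomial.IsHomogeneous.sum _ _ _ fun j _ => ?_
  exact add_comm 1 q ▸ (MvPolynomial.isHomogeneous_C_mul_X _ _).mul
    (MvPolynomial.isHomogeneous_X_pow _ _)

theorem IsHermitianMatrix.eq_zero_of_forall_vanishesAt [Fintype K] {q : ℕ}
    (hK : Fintype.card K = q ^ 2) {H : Matrix (Fin (n + 1)) (Fin (n + 1)) K}
    (hH : IsHermitianMatrix q H) (hr : 2 ≤ H.rank) (hd : d ≤ q) (hF : F.IsHomogeneous d)
    (hvan : ∀ P ∈ hermitianPoints q H, VanishesAt F P) : F = 0 := by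
  refine eq_zero_of_forall_isotropic_eval_eq_zero (hK := hK) (isSymm_hermitianForm hH.2)
    (fun _ => exists_ortho_nonisotropic hH.2 hr) (hF.totalDegree_le.trans hd) fun v hv hiso => ?_
  have hmem : Projectivization.mk K v hv ∈ hermitianPoints q H :=
    (vanishesAt_mk_iff (isHomogeneous_hermitianPoly q H) hv).mpr (hermitianForm_self v ▸ hiso)
  exact (vanishesAt_mk_iff hF hv).mp (hvan _ hmem)

end Points

end HermitianCode

open HermitianCode in
theorem mainTheorem11_general {K : Type*} [Field K] [Fintype K] {q : ℕ}
    (hK : Fintype.card K = q ^ 2) {n d : ℕ} (hd : d ≤ q)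
    {H : Matrix (Fin (n + 1)) (Fin (n + 1)) K} (hH : IsHermitianMatrix q H) (hr : 2 ≤ H.rank) :
    Function.Injective (evalMap d (hermitianPoints q H)) ∧
      ∀ F : MvPolynomial (Fin (n + 1)) K, F.IsHomogeneous d → F ≠ 0 →
        ∃ P ∈ hermitianPoints q H, ¬ VanishesAt F P := by
  refine ⟨(injective_iff_map_eq_zero _).mpr fun ⟨F, hF⟩ hev => Subtype.ext ?_, fun F hF hF0 => ?_⟩
  · exact hH.eq_zero_of_forall_vanishesAt hK hr hd hF fun P hP =>
      (eval_normRep_eq_zero_iff hF P).mp (congrFun hev ⟨P, hP⟩)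
  · by_contra! hvan
    exact hF0 (hH.eq_zero_of_forall_vanishesAt hK hr hd hF hvan)

open HermitianCode in
theorem mainTheorem11 {K : Type*} [Field K] [Fintype K] (q : ℕ) (hq : IsPrimePow q)
    (hK : Fintype.card K = q ^ 2) (n : ℕ) (hn : 3 ≤ n) (d : ℕ) (hd : d ≤ q)
    (H : Matrix (Fin (n + 1)) (Fin (n + 1)) K) (hH : IsHermitianMatrix q H) (hr : H.rank = n) :
    Function.Injective (evalMap d (hermitianPoints q H)) ∧
      ∀ F : MvPolynomial (Fin (n + 1)) K, F.IsHomogeneous d → F ≠ 0 →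
        ∃ P ∈ hermitianPoints q H, ¬ VanishesAt F P :=
  mainTheorem11_general hK hd hH (by omega)
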